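/- **Definitions.** Let $n\ge 0$ be an integer. $\Psi_n$ is the set of functions $\varphi:[0,\infty)\to\mathbb R$ such that $\mathbf t\mapsto\varphi(\mathbf t'\mathbf t)$, $\mathbf t\in\mathbb R^n$, is the characteristic function of some probability measure on $\mathbb R^n$. For $\boldsymbol\mu\in\mathbb R^n$, a symmetric positive semidefinite $n\times n$ matrix $\boldsymbol\Sigma$ and $\varphi\in\Psi_n$, write $\mathbf X\sim E_n(\boldsymbol\mu,\boldsymbol\Sigma,\varphi)$ if the random vector $\mathbf X$ has characteristic function $\mathbf t\mapsto e^{i\mathbf t'\boldsymbol\mu}\varphi(\mathbf t'\boldsymbol\Sigma\mathbf t)$. An $n\times n$ real matrix $\mathbf A$ is *copositive* if $\mathbf x'\mathbf A\mathbf x\ge 0$ for all $\mathbf x\in\mathbb R^n$ with nonnegative entries, and *completely positive* if $\mathbf A=\mathbf B'\mathbf B$ for some $m\times n$ matrix $\mathbf B$ with nonnegative entries (for some $m$). For random vectors $\mathbf X,\mathbf Y$ in $\mathbb R^n$, write $\mathbf X\le_{cp}\mathbf Y$ (respectively $\mathbf X\le_{cop}\mathbf Y$) if $E[f(\mathbf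 X)]\le E[f(\mathbf Y)]$ for every twice continuously differentiable $f:\mathbb R^n\to\mathbb R$ whose Hessian matrix $\mathbf H_f(\mathbf x)$ is completely positive (respectively copositive) at every $\mathbf x\in\mathbb R^n$ and for which $f(\mathbf X)$ and $f(\mathbf Y)$ are integrable. **Theorem 3.11.** Let $\mathbf X\sim E_n(\boldsymbol\mu^x,\boldsymbol\Sigma^x,\varphi)$ and $\mathbf Y\sim E_n(\boldsymbol\mu^y,\boldsymbol\Sigma^y,\varphi)$, where $\varphi$ is not identically $1$ on $[0,\infty)$, and assume that $E\|\mathbf X\|^2<\infty$ and $E\|\mathbf Y\|^2<\infty$. Then 1. $\mathbf X\le_{cp}\mathbf Y$ if and only if $\boldsymbol\mu^x=\boldsymbol\mu^y$ and $\boldsymbol\Sigma^y-\boldsymbol\Sigma^x$ is copositive; 2. $\mathbf X\le_{cop}\mathbf Y$ if and only if $\boldsymbol\mu^x=\boldsymbol\mu^y$ and $\boldsymbol\Sigma^y-\boldsymbol\Sigma^x$ is completely positive. -/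

import Mathlib

open MeasureTheory
open scoped Matrix

namespace HessianOrder

/-- `n`-dimensional Euclidean space. -/
abbrev Vec (n : ℕ) : Type := EuclideanSpace ℝ (Fin n)

/-- The class `Ψ_n` of `n`-dimensional characteristic generators: the functions `φ` (only the
values on `[0, ∞)` matter) such that `t ↦ φ (t' t)` is the characteristic function of some
probability measure on `ℝⁿ`. In particular `φ 0 = 1`. -/
def charGenerators (n : ℕ) : Set (ℝ → ℝ) :=
  {φ | ∃ ν : Measure (Vec n), IsProbabilityMeasure ν ∧
    ∀ t : Vec n, charFun ν t = ((φ (t.ofLp ⬝ᵥ t.ofLp) : ℝ) : ℂ)}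

/-- `X ∼ E_n(μ, S, φ)` under the probability `P`: the dispersion matrix `S` is symmetric positive
semidefinite, `φ ∈ Ψ_n`, and the characteristic function of `X` is
`t ↦ exp (i t'μ) φ (t' S t)`. -/
structure IsElliptical {Ω : Type*} [MeasurableSpace Ω] {n : ℕ} (P : Measure Ω) (X : Ω → Vec n)
    (μ : Vec n) (S : Matrix (Fin n) (Fin n) ℝ) (φ : ℝ → ℝ) : Prop where
  aemeasurable : AEMeasurable X P
  posSemidef : S.PosSemidef
  generator : φ ∈ charGenerators n
  charFun_eq : ∀ t : Vec n, charFun (P.map X) t =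
    Complex.exp (Complex.I * ((t.ofLp ⬝ᵥ μ.ofLp : ℝ) : ℂ)) *
      ((φ (t.ofLp ⬝ᵥ (S *ᵥ t.ofLp)) : ℝ) : ℂ)

/-- The cone of copositive matrices: `x' A x ≥ 0` for all `x ≥ 0`. -/
def copositiveCone (n : ℕ) : Set (Matrix (Fin n) (Fin n) ℝ) :=
  {A | ∀ x : Fin n → ℝ, (∀ i, 0 ≤ x i) → 0 ≤ x ⬝ᵥ (A *ᵥ x)}

/-- The cone of completely positive matrices: `A = B' B` for an entrywise nonnegative `m × n`
matrix `B`, for some `m`. -/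
def completelyPositiveCone (n : ℕ) : Set (Matrix (Fin n) (Fin n) ℝ) :=
  {A | ∃ (m : ℕ) (B : Matrix (Fin m) (Fin n) ℝ), (∀ i j, 0 ≤ B i j) ∧ A = Bᵀ * B}

/-- The partial derivative `∂f/∂xᵢ` at `x`. -/
noncomputable def partialDeriv {n : ℕ} (i : Fin n) (f : Vec n → ℝ) (x : Vec n) : ℝ :=
  fderiv ℝ f x (EuclideanSpace.single i 1)

/-- The Hessian matrix `(∂²f/∂xᵢ∂xⱼ (x))` of `f` at `x`. -/
noncomputable def hessian {n : ℕ} (f : Vec n → ℝ) (x : Vec n) : Matrix (Fin n) (Fin n) ℝ :=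
  Matrix.of fun i j => partialDeriv i (partialDeriv j f) x

/-- The Hessian order generated by a set `C` of matrices: `E[f(X)] ≤ E[f(Y)]` for every twice
continuously differentiable `f : ℝⁿ → ℝ` whose Hessian lies in `C` at every point and for which
both expectations exist. -/
def HessianLE {Ω Ω' : Type*} [MeasurableSpace Ω] [MeasurableSpace Ω'] {n : ℕ}
    (C : Set (Matrix (Fin n) (Fin n) ℝ)) (P : Measure Ω) (X : Ω → Vec n)
    (Q : Measure Ω') (Y : Ω' → Vec n) : Prop :=
  ∀ f : Vec n → ℝ, ContDiff ℝ 2 f → (∀ x, hessian f x ∈ C) →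
    Integrable (fun ω => f (X ω)) P → Integrable (fun ω => f (Y ω)) Q →
    ∫ ω, f (X ω) ∂P ≤ ∫ ω, f (Y ω) ∂Q

/-- `X ≤_cp Y`. -/
def CpLE {Ω Ω' : Type*} [MeasurableSpace Ω] [MeasurableSpace Ω'] {n : ℕ}
    (P : Measure Ω) (X : Ω → Vec n) (Q : Measure Ω') (Y : Ω' → Vec n) : Prop :=
  HessianLE (completelyPositiveCone n) P X Q Y

/-- `X ≤_cop Y`. -/
def CopLE {Ω Ω' : Type*} [MeasurableSpace Ω] [MeasurableSpace Ω'] {n : ℕ}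
    (P : Measure Ω) (X : Ω → Vec n) (Q : Measure Ω') (Y : Ω' → Vec n) : Prop :=
  HessianLE (copositiveCone n) P X Q Y

end HessianOrder

/-!
Both vectors have the law of `μ + A x`, where `x` follows the spherical law `ν` of the generator
and `A A'` is the dispersion matrix. Differentiating integrals over balls along one-parameter
groups of rotations, and summing over the generators of all coordinate planes, gives for every
`C¹` vector field `F` on `ℝᵈ` the identity
`∫ ‖x‖² div F = ∫ ⟪x, DF(x) x⟫ + (d - 1) ∫ ⟪x, F x⟫`.
Applied to `x ↦ F (r x)`, it shows that `r ^ (d - 1) ∫ ⟪x, F (r x)⟫` is monotone in `r` when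
`div F ≥ 0`; hence `∫ ⟪x, F x⟫ ≥ 0`.

The dispersion matrices `S` and `T` are simultaneously diagonalizable by a congruence, so the
segment between them has a differentiable square root. Along it the derivative of `∫ f (μ + A x)`
has the form `∫ ⟪x, F x⟫`, where `div F` is half of the trace of `H_f (T - S)`. Thus `f` increases
in mean as soon as `T - S` lies in the dual of the cone containing `H_f`. Conversely, linear and
quadratic `f` recover the location and the trace pairing, and the copositive and completely
positive cones are dual to each other among symmetric matrices.
-/

namespace HessianOrder

theorem hasDerivAt_setIntegral_of_isCompact {X F : Type*} [TopologicalSpace X] [T2Space X]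
    [MeasurableSpace X] [OpensMeasurableSpace X] [NormedAddCommGroup F] [NormedSpace ℝ F]
    [SecondCountableTopologyEither X F] {ν : Measure X} [IsFiniteMeasureOnCompacts ν] {K : Set X}
    (hK : IsCompact K) {U : Set ℝ} (hU : IsOpen U) {g g' : ℝ → X → F}
    (hg : ∀ l, Continuous (g l)) (hg' : ContinuousOn (Function.uncurry g') (U ×ˢ Set.univ))
    (hderiv : ∀ l ∈ U, ∀ x, HasDerivAt (g · x) (g' l x) l) {l₀ : ℝ} (hl₀ : l₀ ∈ U) :
    HasDerivAt (fun l => ∫ x in K, g l x ∂ν) (∫ x in K, g' l₀ x ∂ν) l₀ := by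
  obtain ⟨δ, hδ, hball⟩ := Metric.nhds_basis_closedBall.mem_iff.1 (hU.mem_nhds hl₀)
  obtain ⟨c, hc⟩ := ((isCompact_closedBall l₀ δ).prod hK).exists_bound_of_continuousOn
    (hg'.mono (Set.prod_mono hball (Set.subset_univ K)))
  have hg'₀ : Continuous (g' l₀) :=
    hg'.comp_continuous (Continuous.prodMk_right l₀) fun x => ⟨hl₀, Set.mem_univ x⟩
  refine (hasDerivAt_integral_of_dominated_loc_of_deriv_le (bound := fun _ => c)
    (Metric.closedBall_mem_nhds l₀ hδ) (.of_forall fun l => (hg l).aestronglyMeasurable)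
    ((hg l₀).continuousOn.integrableOn_compact hK) hg'₀.aestronglyMeasurable ?_
    (integrableOn_const hK.measure_ne_top) (.of_forall fun x l hl => hderiv l (hball hl) x)).2
  exact (ae_restrict_iff' hK.measurableSet).2
    (.of_forall fun x hx l hl => hc (l, x) ⟨hl, hx⟩)

section PlaneRotation

variable {E : Type*} [NormedAddCommGroup E] [InnerProductSpace ℝ E]

open InnerProductSpace in
/-- The generator `x ↦ ⟪u, x⟫ v - ⟪v, x⟫ u` of the rotations in the plane of `u` and `v`. -/
noncomputable def planeRotationGenerator (u v : E) : E →L[ℝ] E := rankOne ℝ v u - rankOne ℝ u v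

theorem planeRotationGenerator_apply (u v x : E) :
    planeRotationGenerator u v x = inner ℝ u x • v - inner ℝ v x • u := rfl

theorem planeRotationGenerator_mem_skewAdjoint [CompleteSpace E] (u v : E) :
    planeRotationGenerator u v ∈ skewAdjoint (E →L[ℝ] E) := by
  simp [planeRotationGenerator, skewAdjoint.mem_iff, ContinuousLinearMap.star_eq_adjoint]

theorem sum_sum_inner_planeRotationGenerator {ι : Type*} [Fintype ι] (b : OrthonormalBasis ι ℝ E)
    (T : E →ₗ[ℝ] E) (x y : E) :
    ∑ i, ∑ j, (inner ℝ (b i) (planeRotationGenerator (b i) (b j) x) * inner ℝ (b j) y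
        + inner ℝ (b i) x * inner ℝ (b j) (T (planeRotationGenerator (b i) (b j) x))) =
      ‖x‖ ^ 2 * T.trace ℝ E - inner ℝ x (T x) - (Module.finrank ℝ E - 1) * inner ℝ x y := by
  classical
  have hsum (y : E) : ∑ i, inner ℝ (b i) x * inner ℝ (b i) y = inner ℝ x y := by
    simpa [real_inner_comm] using b.sum_inner_mul_inner x y
  have hT : ∑ i, inner ℝ (b i) x * inner ℝ x (T (b i)) = inner ℝ x (T x) := by
    conv_rhs => rw [← b.sum_repr' x, map_sum, b.sum_repr' x, inner_sum]
    simp [inner_smul_right]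
  have hinner i : ∑ j, (inner ℝ (b i) (planeRotationGenerator (b i) (b j) x) * inner ℝ (b j) y
        + inner ℝ (b i) x * inner ℝ (b j) (T (planeRotationGenerator (b i) (b j) x))) =
      inner ℝ (b i) x * inner ℝ (b i) y - inner ℝ x y
        + inner ℝ (b i) x * inner ℝ (b i) x * T.trace ℝ E
        - inner ℝ (b i) x * inner ℝ x (T (b i)) := by
    rw [← hsum y, ← hsum (T (b i)), T.trace_eq_sum_inner b]
    simp only [planeRotationGenerator_apply, inner_sub_right, inner_smul_right, b.inner_eq_ite,
      map_sub, map_smul, sub_mul, mul_sub, Finset.sum_add_distrib, Finset.sum_sub_distrib,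
      Finset.mul_sum, mul_assoc]
    simp only [if_true, one_mul, ite_mul, zero_mul, mul_ite, mul_zero, Finset.sum_ite_eq,
      Finset.mem_univ]
    ring
  simp_rw [hinner]
  simp only [Finset.sum_add_distrib, Finset.sum_sub_distrib, ← Finset.sum_mul, hsum, hT,
    real_inner_self_eq_norm_sq, Finset.sum_const, Finset.card_univ,
    Module.finrank_eq_card_basis b.toBasis, nsmul_eq_mul]
  ring

theorem fderiv_inner_mul_inner_apply (u w : E) {F : E → E} {x : E}
    (hF : DifferentiableAt ℝ F x) (v : E) :
    fderiv ℝ (fun x => inner ℝ u x * inner ℝ w (F x)) x v =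
      inner ℝ u v * inner ℝ w (F x) + inner ℝ u x * inner ℝ w (fderiv ℝ F x v) := by
  have hu : HasFDerivAt (fun x : E => inner ℝ u x) (innerSL ℝ u) x := (innerSL ℝ u).hasFDerivAt
  have hw : HasFDerivAt (fun x => inner ℝ w (F x)) ((innerSL ℝ w).comp (fderiv ℝ F x)) x :=
    (innerSL ℝ w).hasFDerivAt.comp x hF.hasFDerivAt
  rw [(hu.fun_mul hw).fderiv]
  simp [mul_comm, add_comm]

end PlaneRotation

section RotationInvariance

variable {E : Type*} [NormedAddCommGroup E] [InnerProductSpace ℝ E] [MeasurableSpace E]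
  [BorelSpace E] {ν : Measure E}

theorem hasDerivAt_setIntegral_inner_comp_smul [FiniteDimensional ℝ E]
    [IsFiniteMeasureOnCompacts ν] {F : E → E} (hF : ContDiff ℝ 1 F) (R r : ℝ) :
    HasDerivAt (fun r : ℝ => ∫ x in Metric.closedBall 0 R, inner ℝ x (F (r • x)) ∂ν)
      (∫ x in Metric.closedBall 0 R, inner ℝ x (fderiv ℝ F (r • x) x) ∂ν) r := by
  have := FiniteDimensional.proper_real E
  have hF' := hF.continuous_fderiv one_ne_zero
  refine hasDerivAt_setIntegral_of_isCompact (isCompact_closedBall (0 : E) R) isOpen_univ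
    (g := fun r x => inner ℝ x (F (r • x))) (g' := fun r x => inner ℝ x (fderiv ℝ F (r • x) x))
    (fun l => continuous_id.inner (hF.continuous.comp (continuous_const_smul l)))
    (continuous_snd.inner ((hF'.comp continuous_smul).clm_apply continuous_snd)).continuousOn
    (fun l _ x => ?_) (Set.mem_univ r)
  have hlx : HasDerivAt (fun r : ℝ => F (r • x)) (fderiv ℝ F (l • x) x) l :=
    (hF.differentiable one_ne_zero _).hasFDerivAt.comp_hasDerivAt (f := fun r : ℝ => r • x) l
      (by simpa using (hasDerivAt_id l).smul_const x)
  simpa using (hasDerivAt_const l x).inner ℝ hlx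

/-- A measure invariant under all linear isometries: the law of a spherical random vector. -/
def IsRotationInvariant (ν : Measure E) : Prop :=
  ∀ O : E ≃ₗᵢ[ℝ] E, MeasurePreserving O ν ν

namespace IsRotationInvariant

theorem integral_comp (hν : IsRotationInvariant ν) {F : Type*} [NormedAddCommGroup F]
    [NormedSpace ℝ F] (O : E ≃ₗᵢ[ℝ] E) (f : E → F) : ∫ x, f (O x) ∂ν = ∫ x, f x ∂ν :=
  (hν O).integral_comp O.toHomeomorph.measurableEmbedding f

theorem integral_eq_zero_of_odd (hν : IsRotationInvariant ν) {F : Type*} [NormedAddCommGroup F]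
    [NormedSpace ℝ F] {f : E → F} (hf : ∀ x, f (-x) = -f x) : ∫ x, f x ∂ν = 0 := by
  have : IsAddTorsionFree F := .of_isTorsionFree ℝ F
  refine self_eq_neg.1 ?_
  calc ∫ x, f x ∂ν = ∫ x, f (-x) ∂ν := (hν.integral_comp (.neg ℝ) f).symm
    _ = -∫ x, f x ∂ν := by simp only [hf, integral_neg]

theorem restrict_closedBall (hν : IsRotationInvariant ν) (R : ℝ) :
    IsRotationInvariant (ν.restrict (Metric.closedBall 0 R)) := fun O => by
  simpa [Metric.closedBall, Set.preimage_ofPred_eq] using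
    (hν O).restrict_preimage (Metric.isClosed_closedBall (x := (0 : E)) (ε := R)).measurableSet

variable [FiniteDimensional ℝ E] [IsFiniteMeasureOnCompacts ν]

theorem setIntegral_fderiv_skewAdjoint_eq_zero (hν : IsRotationInvariant ν) {J : E →L[ℝ] E}
    (hJ : J ∈ skewAdjoint (E →L[ℝ] E)) {h : E → ℝ} (hh : ContDiff ℝ 1 h) (R : ℝ) :
    ∫ x in Metric.closedBall 0 R, fderiv ℝ h x (J x) ∂ν = 0 := by
  have := FiniteDimensional.proper_real E
  let +nondep : NormedAlgebra ℚ (E →L[ℝ] E) := .restrictScalars ℚ ℝ _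
  have hderiv (t : ℝ) : HasDerivAt (fun t : ℝ => NormedSpace.exp (t • J))
      (J * NormedSpace.exp (t • J)) t := hasDerivAt_exp_smul_const' J t
  have hflow : Continuous fun p : ℝ × E => NormedSpace.exp (p.1 • J) p.2 :=
    (by fun_prop : Continuous fun p : ℝ × E => NormedSpace.exp (p.1 • J)).clm_apply continuous_snd
  have hconst (t : ℝ) : ∫ x in Metric.closedBall 0 R, h (NormedSpace.exp (t • J) x) ∂ν =
      ∫ x in Metric.closedBall 0 R, h x ∂ν :=
    (hν.restrict_closedBall R).integral_comp (Unitary.linearIsometryEquiv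
      ⟨_, NormedSpace.exp_mem_unitary_of_mem_skewAdjoint (skewAdjoint.smul_mem t hJ)⟩) h
  have hzero := hasDerivAt_setIntegral_of_isCompact (ν := ν)
    (isCompact_closedBall (0 : E) R) isOpen_univ (g := fun t x => h (NormedSpace.exp (t • J) x))
    (g' := fun t x => fderiv ℝ h (NormedSpace.exp (t • J) x) (J (NormedSpace.exp (t • J) x)))
    (fun t => hh.continuous.comp (ContinuousLinearMap.continuous _))
    (((hh.continuous_fderiv one_ne_zero).comp hflow).clm_apply
      (J.continuous.comp hflow)).continuousOn
    (fun t _ x => (hh.differentiable one_ne_zero _).hasFDerivAt.comp_hasDerivAt t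
      ((hderiv t).clm_apply (hasDerivAt_const t x) |>.congr_deriv (by simp)))
    (Set.mem_univ 0)
  simp only [hconst] at hzero
  simpa using hzero.unique (hasDerivAt_const 0 _)

theorem setIntegral_trace_fderiv_eq (hν : IsRotationInvariant ν) {F : E → E}
    (hF : ContDiff ℝ 1 F) (R : ℝ) :
    ∫ x in Metric.closedBall 0 R, ‖x‖ ^ 2 * (fderiv ℝ F x : E →ₗ[ℝ] E).trace ℝ E ∂ν =
      ∫ x in Metric.closedBall 0 R, inner ℝ x (fderiv ℝ F x x) ∂ν
        + (Module.finrank ℝ E - 1) * ∫ x in Metric.closedBall 0 R, inner ℝ x (F x) ∂ν := by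
  have := FiniteDimensional.proper_real E
  let b := stdOrthonormalBasis ℝ E
  let h i j x : ℝ := inner ℝ (b i) x * inner ℝ (b j) (F x)
  let D i j x := fderiv ℝ (h i j) x (planeRotationGenerator (b i) (b j) x)
  have hh i j : ContDiff ℝ 1 (h i j) :=
    (contDiff_const.inner ℝ contDiff_id).mul (contDiff_const.inner ℝ hF)
  have hint {f : E → ℝ} (hf : Continuous f) : IntegrableOn f (Metric.closedBall 0 R) ν :=
    hf.continuousOn.integrableOn_compact (isCompact_closedBall 0 R)
  have hD i j : IntegrableOn (D i j) (Metric.closedBall 0 R) ν :=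
    hint (((hh i j).continuous_fderiv one_ne_zero).clm_apply (ContinuousLinearMap.continuous _))
  have hD0 : ∫ x in Metric.closedBall 0 R, ∑ i, ∑ j, D i j x ∂ν = 0 := by
    rw [integral_finsetSum _ fun i _ => integrable_finsetSum _ fun j _ => hD i j]
    refine Finset.sum_eq_zero fun i _ => ?_
    rw [integral_finsetSum _ fun j _ => hD i j]
    exact Finset.sum_eq_zero fun j _ => hν.setIntegral_fderiv_skewAdjoint_eq_zero
      (planeRotationGenerator_mem_skewAdjoint _ _) (hh i j) R
  have hsum x : ∑ i, ∑ j, D i j x + (inner ℝ x (fderiv ℝ F x x)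
      + (Module.finrank ℝ E - 1) * inner ℝ x (F x)) =
        ‖x‖ ^ 2 * (fderiv ℝ F x : E →ₗ[ℝ] E).trace ℝ E := by
    have hFx := (hF.differentiable one_ne_zero).differentiableAt (x := x)
    simp only [D, h, fderiv_inner_mul_inner_apply _ _ hFx]
    have := sum_sum_inner_planeRotationGenerator b (fderiv ℝ F x : E →ₗ[ℝ] E) x (F x)
    simp only [ContinuousLinearMap.coe_coe] at this
    rw [this]
    ring
  have hF1 := hint (continuous_id.inner
    ((hF.continuous_fderiv one_ne_zero).clm_apply continuous_id))
  have hF0 := (hint (continuous_id.inner hF.continuous)).const_mul (Module.finrank ℝ E - 1 : ℝ)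
  simp only [id] at hF1 hF0
  simp_rw [← hsum]
  rw [integral_add (integrable_finsetSum _ fun i _ => integrable_finsetSum _ fun j _ => hD i j)
    (hF1.fun_add hF0), integral_add hF1 hF0, hD0, zero_add, integral_const_mul]

theorem mul_setIntegral_inner_fderiv_add_nonneg (hν : IsRotationInvariant ν) {F : E → E}
    (hF : ContDiff ℝ 1 F) (htr : ∀ x, 0 ≤ (fderiv ℝ F x : E →ₗ[ℝ] E).trace ℝ E)
    (R : ℝ) {r : ℝ} (hr : 0 ≤ r) :
    0 ≤ r * ∫ x in Metric.closedBall 0 R, inner ℝ x (fderiv ℝ F (r • x) x) ∂ν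
      + (Module.finrank ℝ E - 1) * ∫ x in Metric.closedBall 0 R, inner ℝ x (F (r • x)) ∂ν := by
  have hderiv x : fderiv ℝ (fun x => F (r • x)) x = r • fderiv ℝ F (r • x) := fderiv_comp_smul r
  have hdiv := hν.setIntegral_trace_fderiv_eq (hF.comp (contDiff_const_smul r)) R
  simp only [Function.comp_def, hderiv, smul_apply, inner_smul_right, integral_const_mul] at hdiv
  rw [← hdiv]
  refine integral_nonneg fun x => mul_nonneg (sq_nonneg _) ?_
  simpa using mul_nonneg hr (htr (r • x))

theorem setIntegral_inner_nonneg_of_trace_fderiv_nonneg (hν : IsRotationInvariant ν) {F : E → E}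
    (hF : ContDiff ℝ 1 F) (htr : ∀ x, 0 ≤ (fderiv ℝ F x : E →ₗ[ℝ] E).trace ℝ E) (R : ℝ) :
    0 ≤ ∫ x in Metric.closedBall 0 R, inner ℝ x (F x) ∂ν := by
  rcases subsingleton_or_nontrivial E with hE | hE
  · simp [Subsingleton.elim _ (0 : E)]
  obtain ⟨k, hk⟩ := Nat.exists_eq_succ_of_ne_zero (Module.finrank_pos (R := ℝ) (M := E)).ne'
  let G (r : ℝ) := ∫ x in Metric.closedBall 0 R, inner ℝ x (F (r • x)) ∂ν
  let G' (r : ℝ) := ∫ x in Metric.closedBall 0 R, inner ℝ x (fderiv ℝ F (r • x) x) ∂ν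
  have hmono : MonotoneOn (fun r => r ^ k * G r) (Set.Icc 0 1) := by
    have hderiv r : HasDerivAt (fun r => r ^ k * G r) (k * r ^ (k - 1) * G r + r ^ k * G' r) r :=
      (hasDerivAt_pow k r).mul (hasDerivAt_setIntegral_inner_comp_smul hF R r)
    refine monotoneOn_of_deriv_nonneg (convex_Icc 0 1)
      (fun r _ => (hderiv r).continuousAt.continuousWithinAt)
      (fun r _ => (hderiv r).differentiableAt.differentiableWithinAt) fun r hr => ?_
    rw [interior_Icc] at hr
    rw [(hderiv r).deriv]
    refine nonneg_of_mul_nonneg_right ?_ hr.1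
    calc 0 ≤ r ^ k * (r * G' r + k * G r) := mul_nonneg (pow_nonneg hr.1.le k) <| by
          simpa [hk] using hν.mul_setIntegral_inner_fderiv_add_nonneg hF htr R hr.1.le
      _ = r * (k * r ^ (k - 1) * G r + r ^ k * G' r) := by
          rcases k with _ | k
          · simp
          · simp; ring
  have hG0 : G 0 = 0 := by
    simpa [G] using (hν.restrict_closedBall R).integral_eq_zero_of_odd
      (f := fun x => inner ℝ x (F 0)) (by simp)
  simpa [hG0, G] using hmono (by simp) (by simp) zero_le_one

end IsRotationInvariant

end RotationInvariance

section SqrtSegment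

variable {s t l : ℝ}

theorem segment_pos_or_eq_zero (hs : 0 ≤ s) (ht : 0 ≤ t) (hl : l ∈ Set.Ioo (0 : ℝ) 1) :
    0 < (1 - l) * s + l * t ∨ s = 0 ∧ t = 0 := by
  rcases hs.eq_or_lt with rfl | hs
  · rcases ht.eq_or_lt with rfl | ht
    · simp
    · exact .inl (by simpa using mul_pos hl.1 ht)
  · exact .inl (add_pos_of_pos_of_nonneg (mul_pos (sub_pos.2 hl.2) hs) (mul_nonneg hl.1.le ht))

theorem hasDerivAt_sqrt_segment (hs : 0 ≤ s) (ht : 0 ≤ t) (hl : l ∈ Set.Ioo (0 : ℝ) 1) :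
    HasDerivAt (fun l => √((1 - l) * s + l * t)) ((t - s) / (2 * √((1 - l) * s + l * t))) l := by
  rcases segment_pos_or_eq_zero hs ht hl with h | ⟨rfl, rfl⟩
  · refine HasDerivAt.sqrt ?_ h.ne'
    exact ((((hasDerivAt_id l).const_sub 1).mul_const s).add
      ((hasDerivAt_id l).mul_const t)).congr_deriv (by ring)
  · simpa using hasDerivAt_const l (0 : ℝ)

theorem continuousOn_deriv_sqrt_segment (hs : 0 ≤ s) (ht : 0 ≤ t) :
    ContinuousOn (fun l => (t - s) / (2 * √((1 - l) * s + l * t))) (Set.Ioo 0 1) := fun l hl => by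
  rcases segment_pos_or_eq_zero hs ht hl with h | ⟨rfl, rfl⟩
  · have := Real.sqrt_pos.2 h
    exact ContinuousAt.continuousWithinAt (by fun_prop (disch := positivity))
  · simpa using continuousWithinAt_const

theorem sqrt_segment_mul_deriv (hs : 0 ≤ s) (ht : 0 ≤ t) (hl : l ∈ Set.Ioo (0 : ℝ) 1) :
    √((1 - l) * s + l * t) * ((t - s) / (2 * √((1 - l) * s + l * t))) = (t - s) / 2 := by
  rcases segment_pos_or_eq_zero hs ht hl with h | ⟨rfl, rfl⟩
  · have := Real.sqrt_pos.2 h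
    field_simp
  · simp

end SqrtSegment

section Interpolation

variable {E G : Type*} [NormedAddCommGroup E] [InnerProductSpace ℝ E] [FiniteDimensional ℝ E]
  [MeasurableSpace E] [BorelSpace E] [NormedAddCommGroup G] [NormedSpace ℝ G] {ν : Measure E}
  [IsFiniteMeasureOnCompacts ν] {ι : Type*} [Fintype ι]

theorem IsRotationInvariant.setIntegral_fderiv_comp_nonneg (hν : IsRotationInvariant ν)
    (b : OrthonormalBasis ι ℝ E) {f : G → ℝ} (hf : ContDiff ℝ 2 f) (μ : G) (B C : E →L[ℝ] G)
    (hBC : ∀ y, 0 ≤ ∑ i, fderiv ℝ (fderiv ℝ f) y (B (b i)) (C (b i))) (R : ℝ) :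
    0 ≤ ∫ x in Metric.closedBall 0 R, fderiv ℝ f (μ + B x) (C x) ∂ν := by
  let riesz : (G →L[ℝ] ℝ) →L[ℝ] E :=
    ∑ i, (ContinuousLinearMap.apply ℝ ℝ (C (b i))).smulRight (b i)
  have hriesz (x : E) (ℓ : G →L[ℝ] ℝ) : inner ℝ x (riesz ℓ) = ℓ (C x) := by
    conv_rhs => rw [← b.sum_repr' x]
    simp [riesz, inner_sum, inner_smul_right, real_inner_comm, mul_comm]
  have hf' : ContDiff ℝ 1 (fderiv ℝ f) := hf.fderiv_right le_rfl
  have hF : ContDiff ℝ 1 fun x => riesz (fderiv ℝ f (μ + B x)) := by fun_prop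
  have hF' x : fderiv ℝ (fun x => riesz (fderiv ℝ f (μ + B x))) x =
      riesz ∘L fderiv ℝ (fderiv ℝ f) (μ + B x) ∘L B :=
    (riesz.hasFDerivAt.comp x ((hf'.differentiable one_ne_zero _).hasFDerivAt.comp x
      (B.hasFDerivAt.const_add μ))).fderiv
  simpa [hriesz] using hν.setIntegral_inner_nonneg_of_trace_fderiv_nonneg hF (fun x => by
    simpa [hF', LinearMap.trace_eq_sum_inner _ b, hriesz] using hBC (μ + B x)) R

theorem IsRotationInvariant.setIntegral_comp_le_of_path (hν : IsRotationInvariant ν)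
    (b : OrthonormalBasis ι ℝ E) {f : G → ℝ} (hf : ContDiff ℝ 2 f) (μ : G)
    {B B' : ℝ → E →L[ℝ] G} (hB : Continuous B)
    (hderiv : ∀ l ∈ Set.Ioo (0 : ℝ) 1, HasDerivAt B (B' l) l)
    (hB' : ContinuousOn B' (Set.Ioo 0 1))
    (hnonneg : ∀ l ∈ Set.Ioo (0 : ℝ) 1, ∀ y,
      0 ≤ ∑ i, fderiv ℝ (fderiv ℝ f) y (B l (b i)) (B' l (b i))) (R : ℝ) :
    ∫ x in Metric.closedBall 0 R, f (μ + B 0 x) ∂ν ≤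
      ∫ x in Metric.closedBall 0 R, f (μ + B 1 x) ∂ν := by
  have := FiniteDimensional.proper_real E
  have hf' : Continuous (fderiv ℝ f) := hf.continuous_fderiv two_ne_zero
  have hpath : Continuous fun p : ℝ × E => μ + B p.1 p.2 := by fun_prop
  have hI (l : ℝ) (hl : l ∈ Set.Ioo (0 : ℝ) 1) : HasDerivAt
      (fun l => ∫ x in Metric.closedBall 0 R, f (μ + B l x) ∂ν)
      (∫ x in Metric.closedBall 0 R, fderiv ℝ f (μ + B l x) (B' l x) ∂ν) l := by
    refine hasDerivAt_setIntegral_of_isCompact (isCompact_closedBall 0 R) isOpen_Ioo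
      (g := fun l x => f (μ + B l x)) (g' := fun l x => fderiv ℝ f (μ + B l x) (B' l x))
      (fun l => by fun_prop) ?_ (fun l hl x => ?_) hl
    · exact (hf'.comp hpath).continuousOn.clm_apply
        ((hB'.comp continuousOn_fst fun _ hp => hp.1).clm_apply continuousOn_snd)
    · have hpathl : HasDerivAt (fun l => μ + B l x) (B' l x) l := by
        simpa using ((hderiv l hl).clm_apply (hasDerivAt_const l x)).const_add μ
      exact (hf.differentiable two_ne_zero _).hasFDerivAt.comp_hasDerivAt l hpathl
  refine monotoneOn_of_deriv_nonneg (convex_Icc 0 1)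
    (continuous_parametric_integral_of_continuous (f := fun l x => f (μ + B l x))
      (hf.continuous.comp hpath) (isCompact_closedBall 0 R)).continuousOn
    (fun l hl => ?_) (fun l hl => ?_) (Set.left_mem_Icc.2 zero_le_one)
    (Set.right_mem_Icc.2 zero_le_one) zero_le_one <;> rw [interior_Icc] at hl
  · exact (hI l hl).differentiableAt.differentiableWithinAt
  · rw [(hI l hl).deriv]
    exact hν.setIntegral_fderiv_comp_nonneg b hf μ (B l) (B' l) (hnonneg l hl) R

theorem IsRotationInvariant.setIntegral_comp_sum_smul_le (hν : IsRotationInvariant ν)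
    (b : OrthonormalBasis ι ℝ E) {f : G → ℝ} (hf : ContDiff ℝ 2 f) (μ : G) (a : ι → G)
    {s t : ι → ℝ} (hs : ∀ i, 0 ≤ s i) (ht : ∀ i, 0 ≤ t i)
    (hst : ∀ y, 0 ≤ ∑ i, (t i - s i) * fderiv ℝ (fderiv ℝ f) y (a i) (a i)) (R : ℝ) :
    ∫ x in Metric.closedBall 0 R, f (μ + ∑ i, (√(s i) * inner ℝ (b i) x) • a i) ∂ν ≤
      ∫ x in Metric.closedBall 0 R, f (μ + ∑ i, (√(t i) * inner ℝ (b i) x) • a i) ∂ν := by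
  classical
  let w i (l : ℝ) : ℝ := √((1 - l) * s i + l * t i)
  let w' i (l : ℝ) : ℝ := (t i - s i) / (2 * w i l)
  let e i : E →L[ℝ] G := (innerSL ℝ (b i)).smulRight (a i)
  have he i j : e i (b j) = if i = j then a i else 0 := by simp [e, b.inner_eq_ite]
  have key := hν.setIntegral_comp_le_of_path b hf μ (B := fun l => ∑ i, w i l • e i)
    (B' := fun l => ∑ i, w' i l • e i) (by fun_prop)
    (fun l hl => HasDerivAt.fun_sum fun i _ =>
      (hasDerivAt_sqrt_segment (hs i) (ht i) hl).smul_const (e i))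
    (continuousOn_finsetSum _ fun i _ =>
      (continuousOn_deriv_sqrt_segment (hs i) (ht i)).smul continuousOn_const) (fun l hl y => ?_) R
  · simpa [w, e, mul_smul] using key
  · calc 0 ≤ 1 / 2 * ∑ i, (t i - s i) * fderiv ℝ (fderiv ℝ f) y (a i) (a i) :=
          mul_nonneg (by norm_num) (hst y)
      _ = ∑ i, w i l * w' i l * fderiv ℝ (fderiv ℝ f) y (a i) (a i) := by
          rw [Finset.mul_sum]
          refine Finset.sum_congr rfl fun i _ => ?_
          rw [sqrt_segment_mul_deriv (hs i) (ht i) hl]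
          ring
      _ = _ := Finset.sum_congr rfl fun i _ => by simp [he, mul_assoc, mul_left_comm]

end Interpolation

section SimultaneousDiagonalization

theorem apply_eq_zero_of_posSemidef {ι : Type*} [Finite ι] {S : Matrix ι ι ℝ} (hS : S.PosSemidef)
    {j : ι} (hj : S j j = 0) (i : ι) : S i j = 0 := by
  classical
  have := Fintype.ofFinite ι
  have h := (hS.dotProduct_mulVec_zero_iff (Pi.single j 1)).1 (by simp [hj])
  simpa using congrFun h i

variable {ι : Type*} [Fintype ι] [DecidableEq ι] {S T : Matrix ι ι ℝ}

theorem exists_orthogonal_diagonalization (hS : S.PosSemidef) :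
    ∃ (U : Matrix ι ι ℝ) (d : ι → ℝ), U * Uᵀ = 1 ∧ Uᵀ * U = 1 ∧ (∀ i, 0 ≤ d i) ∧
      S = U * Matrix.diagonal d * Uᵀ := by
  have hU := Unitary.coe_mul_star_self hS.1.eigenvectorUnitary
  have hU' := Unitary.coe_star_mul_self hS.1.eigenvectorUnitary
  have hspec := hS.1.spectral_theorem
  rw [Unitary.conjStarAlgAut_apply] at hspec
  simp only [Matrix.star_eq_conjTranspose, Matrix.conjTranspose_eq_transpose_of_trivial]
    at hU hU' hspec
  exact ⟨_, _, hU, hU', hS.eigenvalues_nonneg, by simpa [Function.comp_def] using hspec⟩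

theorem mul_diagonal_mul_transpose_eq (A : Matrix ι ι ℝ) {d : ι → ℝ} (hd : ∀ i, 0 ≤ d i) :
    A * Matrix.diagonal d * Aᵀ =
      A * Matrix.diagonal (fun i => √(d i)) * (A * Matrix.diagonal fun i => √(d i))ᵀ := by
  simp only [Matrix.transpose_mul, Matrix.diagonal_transpose, Matrix.mul_assoc,
    ← Matrix.mul_assoc (Matrix.diagonal _) (Matrix.diagonal _), Matrix.diagonal_mul_diagonal,
    Real.mul_self_sqrt (hd _)]

omit [DecidableEq ι] in
theorem exists_eq_mul_transpose (hS : S.PosSemidef) : ∃ A : Matrix ι ι ℝ, S = A * Aᵀ := by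
  classical
  obtain ⟨U, d, -, -, hd, hS⟩ := exists_orthogonal_diagonalization hS
  exact ⟨_, hS.trans (mul_diagonal_mul_transpose_eq U hd)⟩

/-- The positive semidefinite matrices `S` and `T` are diagonalized by one and the same congruence,
which need not be invertible. -/
def SimultaneouslyDiagonalizable (S T : Matrix ι ι ℝ) : Prop :=
  ∃ (A : Matrix ι ι ℝ) (s t : ι → ℝ), (∀ i, 0 ≤ s i) ∧ (∀ i, 0 ≤ t i) ∧
    S = A * Matrix.diagonal s * Aᵀ ∧ T = A * Matrix.diagonal t * Aᵀ

theorem SimultaneouslyDiagonalizable.conj (h : SimultaneouslyDiagonalizable S T)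
    (B : Matrix ι ι ℝ) : SimultaneouslyDiagonalizable (B * S * Bᵀ) (B * T * Bᵀ) := by
  obtain ⟨A, s, t, hs, ht, rfl, rfl⟩ := h
  exact ⟨B * A, s, t, hs, ht, by simp only [Matrix.transpose_mul, Matrix.mul_assoc],
    by simp only [Matrix.transpose_mul, Matrix.mul_assoc]⟩

theorem simultaneouslyDiagonalizable_of_add_eq_one (hS : S.PosSemidef) (hT : T.PosSemidef)
    (hST : S + T = 1) : SimultaneouslyDiagonalizable S T := by
  obtain ⟨V, s, hV, hV', hs, rfl⟩ := exists_orthogonal_diagonalization hS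
  have hTV : Vᵀ * T * V = Matrix.diagonal (1 - s) := by
    calc Vᵀ * T * V = Vᵀ * V - (Vᵀ * V) * Matrix.diagonal s * (Vᵀ * V) := by
          rw [eq_sub_of_add_eq' hST]
          simp only [Matrix.mul_sub, Matrix.sub_mul, Matrix.mul_assoc, Matrix.one_mul]
      _ = Matrix.diagonal (1 - s) := by simp [hV', ← Matrix.diagonal_one, Matrix.diagonal_sub]
  refine ⟨V, s, 1 - s, hs, fun i => ?_, rfl, ?_⟩
  · simpa [Matrix.conjTranspose_eq_transpose_of_trivial, hTV] using
      (hT.conjTranspose_mul_mul_same V).diag_nonneg (i := i)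
  · calc T = (V * Vᵀ) * T * (V * Vᵀ) := by simp [hV]
      _ = V * (Vᵀ * T * V) * Vᵀ := by simp only [Matrix.mul_assoc]
      _ = V * Matrix.diagonal (1 - s) * Vᵀ := by rw [hTV]

theorem diagonal_mul_inv_conj_eq (hS : S.PosSemidef) {d : ι → ℝ}
    (hd : ∀ i, d i = 0 → S i i = 0) :
    Matrix.diagonal d * (Matrix.diagonal d⁻¹ * S * Matrix.diagonal d⁻¹) * Matrix.diagonal d =
      S := by
  have hsymm i j : S j i = S i j := by simpa using hS.1.apply i j
  ext i j
  simp only [Matrix.mul_diagonal, Matrix.diagonal_mul, Pi.inv_apply]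
  by_cases hi : d i = 0
  · simp [hi, hsymm j i ▸ apply_eq_zero_of_posSemidef hS (hd i hi) j]
  by_cases hj : d j = 0
  · simp [hj, apply_eq_zero_of_posSemidef hS (hd j hj) i]
  field_simp

theorem simultaneouslyDiagonalizable_of_add_eq_diagonal (hS : S.PosSemidef) (hT : T.PosSemidef)
    {r : ι → ℝ} (hST : S + T = Matrix.diagonal r) : SimultaneouslyDiagonalizable S T := by
  -- Rescaling makes `S + T` the identity off the kernel of `S + T`; adding the projection onto
  -- that kernel to `T` makes it the identity everywhere, and the inverse scaling removes it again.
  let d i := √(r i)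
  let scale (M : Matrix ι ι ℝ) := Matrix.diagonal d⁻¹ * M * Matrix.diagonal d⁻¹
  let kernel : Matrix ι ι ℝ := Matrix.diagonal fun i => if d i = 0 then 1 else 0
  have hr i : S i i + T i i = r i := by simpa using congrFun₂ hST i i
  have hdd i : d i * d i = r i :=
    Real.mul_self_sqrt (hr i ▸ add_nonneg hS.diag_nonneg hT.diag_nonneg)
  have hd i (hi : d i = 0) : S i i = 0 ∧ T i i = 0 :=
    (add_eq_zero_iff_of_nonneg hS.diag_nonneg hT.diag_nonneg).1 (by rw [hr, ← hdd, hi, zero_mul])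
  have hscale {M : Matrix ι ι ℝ} (hM : M.PosSemidef) : (scale M).PosSemidef := by
    simpa [Matrix.diagonal_conjTranspose] using
      hM.conjTranspose_mul_mul_same (Matrix.diagonal d⁻¹)
  have hkernel : kernel.PosSemidef := .diagonal fun i => by positivity
  have hone : scale S + (scale T + kernel) = 1 := by
    rw [← add_assoc, ← Matrix.add_mul, ← Matrix.mul_add, hST, Matrix.diagonal_mul_diagonal,
      Matrix.diagonal_mul_diagonal, Matrix.diagonal_add, ← Matrix.diagonal_one]
    congr 1
    ext i
    by_cases hi : d i = 0
    · simp [hi]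
    · simp [← hdd, hi]
  have hzero : Matrix.diagonal d * kernel * Matrix.diagonal d = 0 := by
    simp +contextual [kernel, Matrix.diagonal_mul_diagonal]
  have hdiag := (simultaneouslyDiagonalizable_of_add_eq_one (hscale hS)
    ((hscale hT).add hkernel) hone).conj (Matrix.diagonal d)
  rwa [Matrix.diagonal_transpose, Matrix.mul_add, Matrix.add_mul, hzero, add_zero,
    diagonal_mul_inv_conj_eq hS fun i hi => (hd i hi).1,
    diagonal_mul_inv_conj_eq hT fun i hi => (hd i hi).2] at hdiag

theorem simultaneouslyDiagonalizable_of_posSemidef (hS : S.PosSemidef) (hT : T.PosSemidef) :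
    SimultaneouslyDiagonalizable S T := by
  obtain ⟨U, r, hU, hU', -, hST⟩ := exists_orthogonal_diagonalization (hS.add hT)
  have hpos {M : Matrix ι ι ℝ} (hM : M.PosSemidef) : (Uᵀ * M * U).PosSemidef := by
    simpa only [Matrix.conjTranspose_eq_transpose_of_trivial] using hM.conjTranspose_mul_mul_same U
  have hconj (M : Matrix ι ι ℝ) : U * (Uᵀ * M * U) * Uᵀ = M := by
    calc U * (Uᵀ * M * U) * Uᵀ = (U * Uᵀ) * M * (U * Uᵀ) := by simp only [Matrix.mul_assoc]
      _ = M := by simp [hU]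
  have hdiag : Uᵀ * S * U + Uᵀ * T * U = Matrix.diagonal r := by
    calc Uᵀ * S * U + Uᵀ * T * U = (Uᵀ * U) * Matrix.diagonal r * (Uᵀ * U) := by
          rw [← Matrix.add_mul, ← Matrix.mul_add, hST]
          simp only [Matrix.mul_assoc]
      _ = Matrix.diagonal r := by simp [hU']
  simpa only [hconj] using
    (simultaneouslyDiagonalizable_of_add_eq_diagonal (hpos hS) (hpos hT) hdiag).conj U

end SimultaneousDiagonalization

section CompletelyPositive

theorem isCompact_convexHull {E : Type*} [AddCommGroup E] [Module ℝ E]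
    [TopologicalSpace E] [ContinuousAdd E] [ContinuousSMul ℝ E] [FiniteDimensional ℝ E]
    {s : Set E} (hs : IsCompact s) : IsCompact (convexHull ℝ s) := by
  let combos (k : ℕ) : Set E := (fun p : (Fin k → ℝ) × (Fin k → E) => ∑ i, p.1 i • p.2 i) ''
    (stdSimplex ℝ (Fin k) ×ˢ Set.univ.pi fun _ => s)
  have hcombos k : IsCompact (combos k) :=
    ((isCompact_stdSimplex ℝ (Fin k)).prod (isCompact_univ_pi fun _ => hs)).image (by fun_prop)
  suffices convexHull ℝ s = ⋃ k ∈ Set.Iic (Module.finrank ℝ E + 1), combos k by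
    rw [this]
    exact (Set.finite_Iic _).isCompact_biUnion fun k _ => hcombos k
  refine Set.Subset.antisymm (fun x hx => ?_) (Set.iUnion₂_subset fun k _ => ?_)
  · obtain ⟨ι, _, z, w, hz, hind, hw, hw1, rfl⟩ := eq_pos_convex_span_of_mem_convexHull hx
    have hcard : Fintype.card ι ≤ Module.finrank ℝ E + 1 :=
      hind.card_le_finrank_succ.trans (Nat.succ_le_succ (Submodule.finrank_le _))
    let e := (Fintype.equivFin ι).symm
    exact Set.mem_biUnion hcard ⟨(w ∘ e, z ∘ e),
      ⟨⟨fun i => (hw (e i)).le, (e.sum_comp w).trans hw1⟩, fun i _ => hz ⟨e i, rfl⟩⟩,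
      e.sum_comp fun i => w i • z i⟩
  · rintro _ ⟨⟨w, z⟩, ⟨⟨hw, hw1⟩, hz⟩, rfl⟩
    exact (convex_convexHull ℝ s).sum_mem (fun i _ => hw i) hw1
      fun i _ => subset_convexHull ℝ s (hz i (Set.mem_univ i))

variable {n : ℕ} {A B D M : Matrix (Fin n) (Fin n) ℝ}

theorem zero_mem_completelyPositiveCone : 0 ∈ completelyPositiveCone n := ⟨0, 0, by simp, by simp⟩

theorem zero_mem_copositiveCone : 0 ∈ copositiveCone n := fun x _ => by simp

theorem vecMulVec_self_mem_completelyPositiveCone {b : Fin n → ℝ} (hb : ∀ i, 0 ≤ b i) :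
    Matrix.vecMulVec b b ∈ completelyPositiveCone n :=
  ⟨1, Matrix.of fun _ => b, fun _ => hb, by
    ext i j; simp [Matrix.vecMulVec_apply, Matrix.mul_apply]⟩

theorem add_mem_completelyPositiveCone (hA : A ∈ completelyPositiveCone n)
    (hB : B ∈ completelyPositiveCone n) : A + B ∈ completelyPositiveCone n := by
  obtain ⟨k, C, hC, rfl⟩ := hA
  obtain ⟨l, D, hD, rfl⟩ := hB
  refine ⟨k + l, Matrix.of fun i j => Fin.addCases (C · j) (D · j) i, fun i j => ?_, ?_⟩
  · cases i using Fin.addCases with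
    | left i => simpa using hC i j
    | right i => simpa using hD i j
  · ext i j
    simp [Matrix.mul_apply, Fin.sum_univ_add]

theorem smul_mem_completelyPositiveCone {r : ℝ} (hr : 0 ≤ r) (hA : A ∈ completelyPositiveCone n) :
    r • A ∈ completelyPositiveCone n := by
  obtain ⟨k, C, hC, rfl⟩ := hA
  refine ⟨k, √r • C, fun i j => mul_nonneg (Real.sqrt_nonneg r) (hC i j), ?_⟩
  rw [Matrix.transpose_smul, Matrix.smul_mul, Matrix.mul_smul, smul_smul, Real.mul_self_sqrt hr]

theorem convex_completelyPositiveCone : Convex ℝ (completelyPositiveCone n) :=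
  fun _ hA _ hB _ _ ha hb _ => add_mem_completelyPositiveCone
    (smul_mem_completelyPositiveCone ha hA) (smul_mem_completelyPositiveCone hb hB)

theorem transpose_mul_self_eq_sum_vecMulVec {k : ℕ} (B : Matrix (Fin k) (Fin n) ℝ) :
    Bᵀ * B = ∑ l, Matrix.vecMulVec (B l) (B l) := by
  ext i j
  simp [Matrix.mul_apply, Matrix.sum_apply, Matrix.vecMulVec_apply]

/-- The compact base of the completely positive cone: the convex hull of the matrices `b b'`
with `b ≥ 0` in the unit ball. It contains `0`, so that it is nonempty also for `n = 0`. -/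
def completelyPositiveBase (n : ℕ) : Set (Matrix (Fin n) (Fin n) ℝ) :=
  convexHull ℝ ((fun b => Matrix.vecMulVec b b) '' {b : Fin n → ℝ | (∀ i, 0 ≤ b i) ∧ b ⬝ᵥ b ≤ 1})

theorem convex_completelyPositiveBase : Convex ℝ (completelyPositiveBase n) :=
  convex_convexHull ℝ _

theorem isCompact_completelyPositiveBase : IsCompact (completelyPositiveBase n) := by
  refine isCompact_convexHull (IsCompact.image ?_ (continuous_id.matrix_vecMulVec continuous_id))
  refine (isCompact_Icc (a := (0 : Fin n → ℝ)) (b := 1)).of_isClosed_subset ?_ ?_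
  · exact (isClosed_Ici (a := (0 : Fin n → ℝ))).inter
      (isClosed_le (continuous_id.dotProduct continuous_id) continuous_const)
  · refine fun b hb => ⟨hb.1, fun i => ?_⟩
    have : b i * b i ≤ b ⬝ᵥ b :=
      Finset.single_le_sum (fun j _ => mul_self_nonneg (b j)) (Finset.mem_univ i)
    exact le_of_sq_le_sq (by simpa [sq] using this.trans hb.2) zero_le_one

theorem completelyPositiveBase_subset : completelyPositiveBase n ⊆ completelyPositiveCone n :=
  convexHull_min (Set.image_subset_iff.2 fun _ hb =>
    vecMulVec_self_mem_completelyPositiveCone hb.1) convex_completelyPositiveCone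

open scoped Pointwise in
theorem vecMulVec_self_mem_trace_smul_base {b : Fin n → ℝ} (hb : ∀ i, 0 ≤ b i) :
    Matrix.vecMulVec b b ∈ (Matrix.vecMulVec b b).trace • completelyPositiveBase n := by
  have hbb : 0 ≤ b ⬝ᵥ b := Finset.sum_nonneg fun i _ => mul_self_nonneg (b i)
  have hinv : (√(b ⬝ᵥ b))⁻¹ * (√(b ⬝ᵥ b))⁻¹ = (b ⬝ᵥ b)⁻¹ := by
    rw [← mul_inv, Real.mul_self_sqrt hbb]
  rw [Matrix.trace_vecMulVec]
  refine ⟨_, subset_convexHull ℝ _ ⟨(√(b ⬝ᵥ b))⁻¹ • b,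
    ⟨fun i => mul_nonneg (by positivity) (hb i), ?_⟩, rfl⟩, ?_⟩
  · simp only [smul_dotProduct, dotProduct_smul, smul_eq_mul, ← mul_assoc, hinv]
    exact inv_mul_le_one
  · simp only [Matrix.smul_vecMulVec, Matrix.vecMulVec_smul, smul_smul, hinv]
    rcases eq_or_ne b 0 with rfl | hb0
    · simp
    · rw [mul_inv_cancel₀ (by simpa using hb0), one_smul]

open scoped Pointwise in
theorem mem_trace_smul_base_of_mem_completelyPositiveCone (hA : A ∈ completelyPositiveCone n) :
    0 ≤ A.trace ∧ A ∈ A.trace • completelyPositiveBase n := by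
  obtain ⟨k, B, hB, rfl⟩ := hA
  rw [transpose_mul_self_eq_sum_vecMulVec]
  refine Finset.sum_induction _
    (fun A : Matrix (Fin n) (Fin n) ℝ => 0 ≤ A.trace ∧ A ∈ A.trace • completelyPositiveBase n)
    (fun A C hA hC => ?_) ⟨by simp, ?_⟩ fun l _ => ⟨?_, vecMulVec_self_mem_trace_smul_base (hB l)⟩
  · rw [Matrix.trace_add, convex_completelyPositiveBase.add_smul hA.1 hC.1]
    exact ⟨add_nonneg hA.1 hC.1, Set.add_mem_add hA.2 hC.2⟩
  · simpa using vecMulVec_self_mem_trace_smul_base (b := (0 : Fin n → ℝ)) (by simp)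
  · rw [Matrix.trace_vecMulVec]
    exact Finset.sum_nonneg fun i _ => mul_self_nonneg (B l i)

theorem isClosed_completelyPositiveCone : IsClosed (completelyPositiveCone n) := by
  have := isCompact_iff_compactSpace.1 (isCompact_completelyPositiveBase (n := n))
  -- `A` is completely positive iff `A = tr A • T` for some `T` in the compact base, so the cone is
  -- the projection of a closed set along a compact factor.
  let graph : Set (Matrix (Fin n) (Fin n) ℝ × completelyPositiveBase n) :=
    {p | 0 ≤ p.1.trace ∧ p.1 = p.1.trace • (p.2 : Matrix (Fin n) (Fin n) ℝ)}
  have hgraph : IsClosed graph := by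
    have htrace : Continuous fun p : Matrix (Fin n) (Fin n) ℝ × completelyPositiveBase n =>
        p.1.trace := continuous_fst.matrix_trace
    exact (isClosed_le continuous_const htrace).inter (isClosed_eq continuous_fst
      (htrace.smul (continuous_subtype_val.comp continuous_snd)))
  convert isClosedMap_fst_of_compactSpace _ hgraph
  ext A
  refine ⟨fun hA => ?_, ?_⟩
  · obtain ⟨hA0, T, hT, hAT⟩ := mem_trace_smul_base_of_mem_completelyPositiveCone hA
    exact ⟨(A, ⟨T, hT⟩), ⟨hA0, hAT.symm⟩, rfl⟩
  · rintro ⟨⟨A, T⟩, ⟨hA0, hAT⟩, rfl⟩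
    rw [hAT]
    exact smul_mem_completelyPositiveCone hA0 (completelyPositiveBase_subset T.2)

theorem trace_mul_vecMulVec_self (M : Matrix (Fin n) (Fin n) ℝ) (x : Fin n → ℝ) :
    (M * Matrix.vecMulVec x x).trace = x ⬝ᵥ (M *ᵥ x) := by
  rw [Matrix.mul_vecMulVec, Matrix.trace_vecMulVec, dotProduct_comm]

theorem trace_mul_nonneg_of_copositive_of_completelyPositive (hM : M ∈ copositiveCone n)
    (hA : A ∈ completelyPositiveCone n) : 0 ≤ (M * A).trace := by
  obtain ⟨k, B, hB, rfl⟩ := hA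
  rw [transpose_mul_self_eq_sum_vecMulVec, Matrix.mul_sum, Matrix.trace_sum]
  exact Finset.sum_nonneg fun l _ => (trace_mul_vecMulVec_self M (B l)).symm ▸ hM _ (hB l)

theorem exists_trace_mul_eq_of_linearMap (f : Matrix (Fin n) (Fin n) ℝ →ₗ[ℝ] ℝ) :
    ∃ N : Matrix (Fin n) (Fin n) ℝ, ∀ A, f A = (N * A).trace := by
  refine ⟨Matrix.of fun i j => f (Matrix.single j i 1), fun A => ?_⟩
  conv_lhs => rw [Matrix.matrix_eq_sum_single A]
  simp only [map_sum, Matrix.trace, Matrix.diag_apply, Matrix.mul_apply, Matrix.of_apply]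
  rw [Finset.sum_comm]
  refine Finset.sum_congr rfl fun j _ => Finset.sum_congr rfl fun i _ => ?_
  rw [mul_comm, ← smul_eq_mul, ← map_smul, Matrix.smul_single, smul_eq_mul, mul_one]

theorem mem_completelyPositiveCone_of_trace_mul_nonneg (hD : Dᵀ = D)
    (h : ∀ M ∈ copositiveCone n, Mᵀ = M → 0 ≤ (M * D).trace) : D ∈ completelyPositiveCone n := by
  by_contra hDC
  have : LocallyConvexSpace ℝ (Matrix (Fin n) (Fin n) ℝ) :=
    inferInstanceAs (LocallyConvexSpace ℝ (Fin n → Fin n → ℝ))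
  let C : ProperCone ℝ (Matrix (Fin n) (Fin n) ℝ) :=
    { carrier := completelyPositiveCone n
      add_mem' := add_mem_completelyPositiveCone
      zero_mem' := zero_mem_completelyPositiveCone
      smul_mem' := fun r _ => smul_mem_completelyPositiveCone r.2
      isClosed' := isClosed_completelyPositiveCone }
  obtain ⟨f, hf, hfD⟩ := C.hyperplane_separation_point hDC
  obtain ⟨N, hN⟩ := exists_trace_mul_eq_of_linearMap f.toLinearMap
  have hsymm {A : Matrix (Fin n) (Fin n) ℝ} (hA : Aᵀ = A) :
      ((N + Nᵀ) * A).trace = 2 * f A := by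
    have : (Nᵀ * A).trace = (N * A).trace := by
      rw [← Matrix.trace_transpose, Matrix.transpose_mul, hA, Matrix.transpose_transpose,
        Matrix.trace_mul_comm]
    rw [Matrix.add_mul, Matrix.trace_add, this, ← hN, ← two_mul]
    rfl
  have hcop : N + Nᵀ ∈ copositiveCone n := fun x hx => by
    rw [← trace_mul_vecMulVec_self, hsymm (Matrix.transpose_vecMulVec x x)]
    exact mul_nonneg zero_le_two (hf _ (vecMulVec_self_mem_completelyPositiveCone hx))
  have := h _ hcop (by simp [add_comm])
  rw [hsymm hD] at this
  linarith

end CompletelyPositive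

section SecondMoments

theorem charFun_eq_one_of_integral_norm_sq_eq_zero {E : Type*} [NormedAddCommGroup E]
    [InnerProductSpace ℝ E] [MeasurableSpace E] {ν : Measure E} [IsProbabilityMeasure ν]
    (h2 : Integrable (fun x => ‖x‖ ^ 2) ν) (h0 : ∫ x, ‖x‖ ^ 2 ∂ν = 0) (t : E) :
    charFun ν t = 1 := by
  have hae := (integral_eq_zero_iff_of_nonneg (fun x => sq_nonneg ‖x‖) h2).1 h0
  rw [charFun_apply]
  calc _ = ∫ _, (1 : ℂ) ∂ν := integral_congr_ae <| hae.mono fun x hx => by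
        simp [show x = 0 by simpa using hx]
    _ = 1 := by simp

variable {E : Type*} [NormedAddCommGroup E] [InnerProductSpace ℝ E] [FiniteDimensional ℝ E]
  [MeasurableSpace E] [BorelSpace E] {ν : Measure E} [IsFiniteMeasureOnCompacts ν]

namespace IsRotationInvariant

theorem setIntegral_inner_clm (hν : IsRotationInvariant ν) (L : E →L[ℝ] E) (R : ℝ) :
    Module.finrank ℝ E * ∫ x in Metric.closedBall 0 R, inner ℝ x (L x) ∂ν =
      (L : E →ₗ[ℝ] E).trace ℝ E * ∫ x in Metric.closedBall 0 R, ‖x‖ ^ 2 ∂ν := by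
  have h := hν.setIntegral_trace_fderiv_eq L.contDiff R
  simp only [L.fderiv, integral_mul_const] at h
  linarith

theorem integral_inner_clm (hν : IsRotationInvariant ν) (h2 : Integrable (fun x => ‖x‖ ^ 2) ν)
    (L : E →L[ℝ] E) :
    Module.finrank ℝ E * ∫ x, inner ℝ x (L x) ∂ν =
      (L : E →ₗ[ℝ] E).trace ℝ E * ∫ x, ‖x‖ ^ 2 ∂ν := by
  have hball : AECover ν Filter.atTop fun N : ℕ => Metric.closedBall (0 : E) N :=
    aecover_closedBall tendsto_natCast_atTop_atTop
  have hL : Integrable (fun x => inner ℝ x (L x)) ν := by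
    refine (h2.const_mul ‖L‖).mono' (by fun_prop) (.of_forall fun x => ?_)
    calc ‖inner ℝ x (L x)‖ ≤ ‖x‖ * (‖L‖ * ‖x‖) := (norm_inner_le_norm _ _).trans (by
          gcongr; exact L.le_opNorm x)
      _ = ‖L‖ * ‖x‖ ^ 2 := by ring
  refine tendsto_nhds_unique
    ((hball.integral_tendsto_of_countably_generated hL).const_mul _) ?_
  simp only [hν.setIntegral_inner_clm]
  exact (hball.integral_tendsto_of_countably_generated h2).const_mul _

theorem integrable_norm_sq (hν : IsRotationInvariant ν) {L : E →L[ℝ] E}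
    (hL : Integrable (fun x => inner ℝ x (L x)) ν) (htr : 0 < (L : E →ₗ[ℝ] E).trace ℝ E) :
    Integrable (fun x => ‖x‖ ^ 2) ν := by
  have := FiniteDimensional.proper_real E
  have hball : AECover ν Filter.atTop fun N : ℕ => Metric.closedBall (0 : E) N :=
    aecover_closedBall tendsto_natCast_atTop_atTop
  refine hball.integrable_of_integral_bounded_of_nonneg_ae
    (Module.finrank ℝ E * (∫ x, ‖inner ℝ x (L x)‖ ∂ν) / (L : E →ₗ[ℝ] E).trace ℝ E)
    (fun N => (by fun_prop : Continuous fun x : E => ‖x‖ ^ 2).continuousOn.integrableOn_compact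
      (isCompact_closedBall 0 _)) (.of_forall fun x => sq_nonneg _) (.of_forall fun N => ?_)
  rw [le_div_iff₀ htr, mul_comm, ← hν.setIntegral_inner_clm]
  gcongr
  calc ∫ x in Metric.closedBall 0 (N : ℝ), inner ℝ x (L x) ∂ν
      ≤ ∫ x in Metric.closedBall 0 (N : ℝ), ‖inner ℝ x (L x)‖ ∂ν :=
        integral_mono hL.integrableOn hL.norm.integrableOn fun x => le_abs_self _
    _ ≤ ∫ x, ‖inner ℝ x (L x)‖ ∂ν :=
        setIntegral_le_integral hL.norm (.of_forall fun x => norm_nonneg _)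

end IsRotationInvariant

end SecondMoments

section Hessian

variable {n : ℕ} {f : Vec n → ℝ}

theorem hessian_apply (hf : ContDiff ℝ 2 f) (x : Vec n) (i j : Fin n) :
    hessian f x i j =
      fderiv ℝ (fderiv ℝ f) x (EuclideanSpace.single i 1) (EuclideanSpace.single j 1) := by
  have hf' : DifferentiableAt ℝ (fderiv ℝ f) x :=
    (hf.fderiv_right (m := 1) le_rfl).differentiable one_ne_zero x
  change fderiv ℝ (fun y => fderiv ℝ f y (EuclideanSpace.single j 1)) x _ = _
  simp [fderiv_clm_apply hf' (differentiableAt_const _)]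

theorem fderiv_fderiv_apply_eq_dotProduct (hf : ContDiff ℝ 2 f) (x v w : Vec n) :
    fderiv ℝ (fderiv ℝ f) x v w = v.ofLp ⬝ᵥ (hessian f x *ᵥ w.ofLp) := by
  have hsum (v : Vec n) : v = ∑ i, v i • EuclideanSpace.single i (1 : ℝ) := by
    simpa using ((EuclideanSpace.basisFun (Fin n) ℝ).sum_repr v).symm
  conv_lhs => rw [hsum v, hsum w]
  simpa [dotProduct, Matrix.mulVec, hessian_apply hf, Finset.mul_sum, mul_comm, mul_left_comm]
    using Finset.sum_comm

theorem sum_mul_fderiv_fderiv_eq_trace (hf : ContDiff ℝ 2 f) (A : Matrix (Fin n) (Fin n) ℝ)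
    (d : Fin n → ℝ) (x : Vec n) :
    ∑ i, d i * fderiv ℝ (fderiv ℝ f) x (WithLp.toLp 2 (A.col i)) (WithLp.toLp 2 (A.col i)) =
      (hessian f x * (A * Matrix.diagonal d * Aᵀ)).trace := by
  have hA : A * Matrix.diagonal d * Aᵀ = ∑ i, d i • Matrix.vecMulVec (A.col i) (A.col i) := by
    ext i j
    simp only [Matrix.mul_apply (N := Aᵀ), Matrix.mul_diagonal, Matrix.sum_apply,
      Matrix.smul_apply, Matrix.vecMulVec_apply, Matrix.transpose_apply, Matrix.col_apply,
      smul_eq_mul]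
    exact Finset.sum_congr rfl fun k _ => by ring
  simp [hA, Matrix.mul_sum, Matrix.trace_sum, trace_mul_vecMulVec_self,
    fderiv_fderiv_apply_eq_dotProduct hf]

theorem hessian_clm (ℓ : Vec n →L[ℝ] ℝ) (x : Vec n) : hessian ℓ x = 0 := by
  ext i j
  have hℓ : fderiv ℝ ℓ = fun _ => ℓ := funext fun _ => ℓ.fderiv
  simp [hessian_apply ℓ.contDiff, hℓ]

/-- The quadratic function `y ↦ (y - μ)' M (y - μ) / 2`, whose Hessian is `M` when `M` is
symmetric. -/
noncomputable def halfQuadraticForm (M : Matrix (Fin n) (Fin n) ℝ) (μ y : Vec n) : ℝ :=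
  1 / 2 * inner ℝ (y - μ) (Matrix.toEuclideanCLM (𝕜 := ℝ) M (y - μ))

theorem contDiff_halfQuadraticForm (M : Matrix (Fin n) (Fin n) ℝ) (μ : Vec n) :
    ContDiff ℝ 2 (halfQuadraticForm M μ) := by
  have hsub : ContDiff ℝ 2 fun y : Vec n => y - μ := by fun_prop
  exact contDiff_const.mul (hsub.inner ℝ ((ContinuousLinearMap.contDiff _).comp hsub))

variable {M : Matrix (Fin n) (Fin n) ℝ}

theorem hasFDerivAt_halfQuadraticForm (hM : Mᵀ = M) (μ y : Vec n) :
    HasFDerivAt (halfQuadraticForm M μ)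
      (innerSL ℝ (Matrix.toEuclideanCLM (𝕜 := ℝ) M (y - μ))) y := by
  have hsymm : (Matrix.toEuclideanCLM (𝕜 := ℝ) M : Vec n →ₗ[ℝ] Vec n).IsSymmetric :=
    Matrix.isSymmetric_toEuclideanLin_iff.2 hM
  have h := ((hsymm.hasStrictFDerivAt_reApplyInnerSelf (y - μ)).hasFDerivAt.comp y
    ((hasFDerivAt_id y).sub_const μ)).const_mul (1 / 2 : ℝ)
  refine (h.congr_fderiv ?_).congr_of_eventuallyEq (.of_forall fun z => ?_)
  · ext v; simp
  · simp [halfQuadraticForm, ContinuousLinearMap.reApplyInnerSelf_apply, real_inner_comm]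

theorem hessian_halfQuadraticForm (hM : Mᵀ = M) (μ x : Vec n) :
    hessian (halfQuadraticForm M μ) x = M := by
  have hderiv : fderiv ℝ (halfQuadraticForm M μ) = fun y =>
      (innerSL ℝ ∘L Matrix.toEuclideanCLM (𝕜 := ℝ) M) (y - μ) :=
    funext fun y => (hasFDerivAt_halfQuadraticForm hM μ y).fderiv
  ext i j
  rw [hessian_apply (contDiff_halfQuadraticForm M μ), hderiv, fderiv_comp_sub,
    ContinuousLinearMap.fderiv]
  calc inner ℝ (Matrix.toEuclideanCLM (𝕜 := ℝ) M (EuclideanSpace.single i 1))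
        (EuclideanSpace.single j 1) = M j i := by simp [EuclideanSpace.inner_single_right]
    _ = M i j := congrFun (congrFun hM i) j

end Hessian

section Elliptical

variable {n : ℕ} {φ : ℝ → ℝ} {ν : Measure (Vec n)}

/-- `ν` is the spherical law on `ℝⁿ` with characteristic generator `φ`: a witness of
`φ ∈ charGenerators n`. -/
def HasCharGenerator (ν : Measure (Vec n)) (φ : ℝ → ℝ) : Prop :=
  ∀ t : Vec n, charFun ν t = ((φ (t.ofLp ⬝ᵥ t.ofLp) : ℝ) : ℂ)

theorem HasCharGenerator.charFun_eq (hν : HasCharGenerator ν φ) (t : Vec n) :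
    charFun ν t = ((φ (‖t‖ ^ 2) : ℝ) : ℂ) := by
  rw [hν t, EuclideanSpace.real_norm_sq_eq]
  simp [dotProduct, sq]

theorem HasCharGenerator.isRotationInvariant [IsFiniteMeasure ν] (hν : HasCharGenerator ν φ) :
    IsRotationInvariant ν := fun O => by
  refine ⟨O.continuous.measurable, Measure.ext_of_charFun (funext fun t => ?_)⟩
  calc charFun (ν.map O) t = charFun ν (O.symm t) := by
        rw [charFun_apply, charFun_apply,
          integral_map O.continuous.measurable.aemeasurable (by fun_prop)]
        simp_rw [← O.inner_map_map _ (O.symm t), O.apply_symm_apply]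
    _ = charFun ν t := by simp only [hν.charFun_eq, LinearIsometryEquiv.norm_map]

theorem HasCharGenerator.integral_norm_sq_pos [IsProbabilityMeasure ν] (hν : HasCharGenerator ν φ)
    (hn : n ≠ 0) (hφ : ∃ u : ℝ, 0 ≤ u ∧ φ u ≠ 1) (h2 : Integrable (fun x => ‖x‖ ^ 2) ν) :
    0 < ∫ x, ‖x‖ ^ 2 ∂ν := by
  refine (integral_nonneg fun x => sq_nonneg ‖x‖).lt_of_ne' fun h0 => ?_
  obtain ⟨u, hu, hφu⟩ := hφ
  have : NeZero n := ⟨hn⟩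
  have h1 := charFun_eq_one_of_integral_norm_sq_eq_zero h2 h0 (EuclideanSpace.single 0 √u)
  rw [hν.charFun_eq, PiLp.norm_single, Real.norm_of_nonneg (Real.sqrt_nonneg u),
    Real.sq_sqrt hu] at h1
  exact hφu (by exact_mod_cast h1)

theorem inner_toEuclideanCLM_left (A : Matrix (Fin n) (Fin n) ℝ) (x y : Vec n) :
    inner ℝ (Matrix.toEuclideanCLM (𝕜 := ℝ) A x) y =
      inner ℝ x (Matrix.toEuclideanCLM (𝕜 := ℝ) Aᵀ y) := by
  rw [real_inner_comm, Matrix.inner_toEuclideanCLM, Matrix.inner_toEuclideanCLM,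
    Matrix.dotProduct_mulVec, dotProduct_comm, Matrix.mulVec_transpose]

theorem trace_toEuclideanCLM (A : Matrix (Fin n) (Fin n) ℝ) :
    (Matrix.toEuclideanCLM (𝕜 := ℝ) A : Vec n →ₗ[ℝ] Vec n).trace ℝ (Vec n) = A.trace := by
  rw [LinearMap.trace_eq_sum_inner _ (EuclideanSpace.basisFun (Fin n) ℝ)]
  simp [Matrix.trace, EuclideanSpace.inner_single_left]

theorem toEuclideanCLM_mul_diagonal (A : Matrix (Fin n) (Fin n) ℝ) (d : Fin n → ℝ) (x : Vec n) :
    Matrix.toEuclideanCLM (𝕜 := ℝ) (A * Matrix.diagonal d) x =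
      ∑ i, (d i * inner ℝ (EuclideanSpace.basisFun (Fin n) ℝ i) x) • WithLp.toLp 2 (A.col i) := by
  ext j
  simp [-map_mul, Matrix.ofLp_toEuclideanCLM, Matrix.mulVec, dotProduct,
    EuclideanSpace.inner_single_left, mul_assoc, mul_comm]

variable {Ω : Type*} [MeasurableSpace Ω] {P : Measure Ω} [IsFiniteMeasure P] [IsFiniteMeasure ν]
  {X : Ω → Vec n} {μ : Vec n} {S A : Matrix (Fin n) (Fin n) ℝ}

theorem IsElliptical.identDistrib (hX : IsElliptical P X μ S φ) (hν : HasCharGenerator ν φ)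
    (hA : S = A * Aᵀ) :
    ProbabilityTheory.IdentDistrib X (fun x => μ + Matrix.toEuclideanCLM (𝕜 := ℝ) A x) P ν := by
  refine ⟨hX.aemeasurable, by fun_prop, Measure.ext_of_charFun (funext fun t => ?_)⟩
  rw [hX.charFun_eq, charFun_apply, integral_map (by fun_prop) (by fun_prop)]
  simp_rw [inner_add_left, Complex.ofReal_add, add_mul, Complex.exp_add, integral_const_mul,
    inner_toEuclideanCLM_left]
  rw [← charFun_apply, hν, hA]
  congr 2
  · rw [mul_comm, EuclideanSpace.inner_eq_star_dotProduct, star_trivial]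
  · rw [← Matrix.mulVec_mulVec, Matrix.dotProduct_mulVec, ← Matrix.mulVec_transpose,
      Matrix.ofLp_toEuclideanCLM]

theorem IsElliptical.integral_eq_location [IsProbabilityMeasure ν] (hX : IsElliptical P X μ S φ)
    (hν : HasCharGenerator ν φ) (hXint : Integrable X P) : ∫ ω, X ω ∂P = μ := by
  obtain ⟨A, hA⟩ := exists_eq_mul_transpose hX.posSemidef
  have hlaw := hX.identDistrib hν hA
  have hAint : Integrable (fun x => Matrix.toEuclideanCLM (𝕜 := ℝ) A x) ν :=
    (integrable_add_iff_integrable_right' (integrable_const μ)).1 (hlaw.integrable_iff.1 hXint)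
  rw [hlaw.integral_eq, integral_add (integrable_const μ) hAint,
    hν.isRotationInvariant.integral_eq_zero_of_odd fun x => map_neg _ x]
  simp

theorem IsElliptical.integrable_norm_sq (hX : IsElliptical P X μ S φ)
    (hν : HasCharGenerator ν φ) (hX2 : MemLp X 2 P) (hS : S ≠ 0) :
    Integrable (fun x => ‖x‖ ^ 2) ν := by
  obtain ⟨A, hA⟩ := exists_eq_mul_transpose hX.posSemidef
  have hAA x : inner ℝ x (Matrix.toEuclideanCLM (𝕜 := ℝ) (Aᵀ * A) x) =
      ‖Matrix.toEuclideanCLM (𝕜 := ℝ) A x‖ ^ 2 := by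
    rw [← real_inner_self_eq_norm_sq, inner_toEuclideanCLM_left, map_mul]
    rfl
  have hlaw := (hX.identDistrib hν hA).comp (u := fun y => ‖y - μ‖ ^ 2) (by fun_prop)
  refine hν.isRotationInvariant.integrable_norm_sq
    (L := Matrix.toEuclideanCLM (𝕜 := ℝ) (Aᵀ * A)) ?_ ?_
  · simpa only [hAA, Function.comp_def, add_sub_cancel_left] using
      hlaw.integrable_iff.1 (hX2.sub (memLp_const μ)).integrable_norm_pow'
  · rw [trace_toEuclideanCLM, Matrix.trace_mul_comm, ← hA]
    exact hX.posSemidef.trace_nonneg.lt_of_ne' (mt hX.posSemidef.trace_eq_zero_iff.1 hS)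

theorem IsElliptical.integral_halfQuadraticForm (hX : IsElliptical P X μ S φ)
    (hν : HasCharGenerator ν φ) (h2 : Integrable (fun x => ‖x‖ ^ 2) ν)
    (M : Matrix (Fin n) (Fin n) ℝ) :
    n * ∫ ω, halfQuadraticForm M μ (X ω) ∂P = 1 / 2 * (∫ x, ‖x‖ ^ 2 ∂ν) * (M * S).trace := by
  obtain ⟨A, hA⟩ := exists_eq_mul_transpose hX.posSemidef
  have hlaw := (hX.identDistrib hν hA).comp (contDiff_halfQuadraticForm M μ).continuous.measurable
  have hform x : halfQuadraticForm M μ (μ + Matrix.toEuclideanCLM (𝕜 := ℝ) A x) =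
      1 / 2 * inner ℝ x (Matrix.toEuclideanCLM (𝕜 := ℝ) (Aᵀ * M * A) x) := by
    simp only [halfQuadraticForm, add_sub_cancel_left, inner_toEuclideanCLM_left, map_mul]
    rfl
  have hmoment := hν.isRotationInvariant.integral_inner_clm h2
    (Matrix.toEuclideanCLM (𝕜 := ℝ) (Aᵀ * M * A))
  rw [finrank_euclideanSpace_fin, trace_toEuclideanCLM, Matrix.mul_assoc, Matrix.trace_mul_comm,
    Matrix.mul_assoc, ← hA] at hmoment
  calc n * ∫ ω, halfQuadraticForm M μ (X ω) ∂P
      = n * ∫ x, halfQuadraticForm M μ (μ + Matrix.toEuclideanCLM (𝕜 := ℝ) A x) ∂ν := by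
        exact congrArg (n * · : ℝ → ℝ) hlaw.integral_eq
    _ = 1 / 2 * (∫ x, ‖x‖ ^ 2 ∂ν) * (M * S).trace := by
        simp only [hform, integral_const_mul, Matrix.mul_assoc]
        linarith

theorem integrable_halfQuadraticForm (hX2 : MemLp X 2 P) (M : Matrix (Fin n) (Fin n) ℝ)
    (μ : Vec n) : Integrable (fun ω => halfQuadraticForm M μ (X ω)) P := by
  have hXμ := hX2.sub (memLp_const μ)
  have hM : MemLp (fun ω => Matrix.toEuclideanCLM (𝕜 := ℝ) M (X ω - μ)) 2 P :=
    (Matrix.toEuclideanCLM (𝕜 := ℝ) M).comp_memLp' hXμ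
  exact (MemLp.integrable_mul hXμ.norm hM.norm |>.mono'
    (hXμ.1.inner hM.1) (.of_forall fun ω => norm_inner_le_norm _ _)).const_mul _

end Elliptical

section HessianOrder

variable {Ω Ω' : Type*} [MeasurableSpace Ω] [MeasurableSpace Ω'] {P : Measure Ω} {Q : Measure Ω'}
  {n : ℕ} {X : Ω → Vec n} {Y : Ω' → Vec n} {μ μ' : Vec n} {S T : Matrix (Fin n) (Fin n) ℝ}
  {φ : ℝ → ℝ} {C : Set (Matrix (Fin n) (Fin n) ℝ)}

theorem hessianLE_of_trace_nonneg [IsFiniteMeasure P] [IsFiniteMeasure Q]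
    (hX : IsElliptical P X μ S φ) (hY : IsElliptical Q Y μ T φ)
    (hC : ∀ M ∈ C, 0 ≤ (M * (T - S)).trace) : HessianLE C P X Q Y := by
  intro f hf hfC hfX hfY
  obtain ⟨ν, _, hν : HasCharGenerator ν φ⟩ := hX.generator
  obtain ⟨A, s, t, hs, ht, hS, hT⟩ :=
    simultaneouslyDiagonalizable_of_posSemidef hX.posSemidef hY.posSemidef
  have hXlaw := (hX.identDistrib hν (hS.trans (mul_diagonal_mul_transpose_eq A hs))).comp
    hf.continuous.measurable
  have hYlaw := (hY.identDistrib hν (hT.trans (mul_diagonal_mul_transpose_eq A ht))).comp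
    hf.continuous.measurable
  simp only [toEuclideanCLM_mul_diagonal] at hXlaw hYlaw
  have hTS : T - S = A * Matrix.diagonal (t - s) * Aᵀ := by
    rw [hS, hT, ← Matrix.sub_mul, ← Matrix.mul_sub, Matrix.diagonal_sub]
    rfl
  have hle := hν.isRotationInvariant.setIntegral_comp_sum_smul_le
    (EuclideanSpace.basisFun (Fin n) ℝ) hf μ (fun i => WithLp.toLp 2 (A.col i)) hs ht fun y => by
      simpa [hTS, ← sum_mul_fderiv_fderiv_eq_trace hf] using hC _ (hfC y)
  have hball : AECover ν Filter.atTop fun N : ℕ => Metric.closedBall (0 : Vec n) N :=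
    aecover_closedBall tendsto_natCast_atTop_atTop
  have hlim := le_of_tendsto_of_tendsto'
    (hball.integral_tendsto_of_countably_generated (hXlaw.integrable_iff.1 hfX))
    (hball.integral_tendsto_of_countably_generated (hYlaw.integrable_iff.1 hfY)) fun N => hle N
  rwa [← hXlaw.integral_eq, ← hYlaw.integral_eq] at hlim

variable [IsProbabilityMeasure P] [IsProbabilityMeasure Q]

theorem HessianLE.location_eq (h : HessianLE C P X Q Y) (hX : IsElliptical P X μ S φ)
    (hY : IsElliptical Q Y μ' T φ) (hX1 : Integrable X P) (hY1 : Integrable Y Q) (h0 : 0 ∈ C) :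
    μ = μ' := by
  obtain ⟨ν, _, hν : HasCharGenerator ν φ⟩ := hX.generator
  let ℓ : Vec n →L[ℝ] ℝ := innerSL ℝ (μ - μ')
  have hℓ := h ℓ ℓ.contDiff (fun x => by rwa [hessian_clm]) (ℓ.integrable_comp hX1)
    (ℓ.integrable_comp hY1)
  rw [ℓ.integral_comp_comm hX1, ℓ.integral_comp_comm hY1, hX.integral_eq_location hν hX1,
    hY.integral_eq_location hν hY1, ← sub_nonpos, ← map_sub] at hℓ
  exact sub_eq_zero.1 (real_inner_self_nonpos.1 hℓ)

theorem HessianLE.trace_nonneg (h : HessianLE C P X Q Y) (hX : IsElliptical P X μ S φ)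
    (hY : IsElliptical Q Y μ T φ) (hφ : ∃ u : ℝ, 0 ≤ u ∧ φ u ≠ 1) (hX2 : MemLp X 2 P)
    (hY2 : MemLp Y 2 Q) {M : Matrix (Fin n) (Fin n) ℝ} (hMC : M ∈ C) (hM : Mᵀ = M) :
    0 ≤ (M * (T - S)).trace := by
  obtain ⟨ν, _, hν : HasCharGenerator ν φ⟩ := hX.generator
  by_cases hST : S = 0 ∧ T = 0
  · simp [hST]
  have h2 : Integrable (fun x => ‖x‖ ^ 2) ν := (not_and_or.1 hST).elim
    (hX.integrable_norm_sq hν hX2) (hY.integrable_norm_sq hν hY2)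
  have hn : n ≠ 0 := by
    rintro rfl
    exact hST ⟨Subsingleton.elim _ _, Subsingleton.elim _ _⟩
  have hpos := hν.integral_norm_sq_pos hn hφ h2
  have hle := mul_le_mul_of_nonneg_left (h _ (contDiff_halfQuadraticForm M μ)
    (fun x => by rwa [hessian_halfQuadraticForm hM]) (integrable_halfQuadraticForm hX2 M μ)
    (integrable_halfQuadraticForm hY2 M μ)) n.cast_nonneg
  rw [hX.integral_halfQuadraticForm hν h2, hY.integral_halfQuadraticForm hν h2] at hle
  rw [Matrix.mul_sub, Matrix.trace_sub, sub_nonneg]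
  exact le_of_mul_le_mul_left hle (by positivity)

end HessianOrder

end HessianOrder

theorem theorem3p11 {Ω Ω' : Type*} [MeasurableSpace Ω] [MeasurableSpace Ω']
    (P : Measure Ω) [IsProbabilityMeasure P] (Q : Measure Ω') [IsProbabilityMeasure Q]
    (n : ℕ) (X : Ω → HessianOrder.Vec n) (Y : Ω' → HessianOrder.Vec n)
    (μx μy : HessianOrder.Vec n) (Sx Sy : Matrix (Fin n) (Fin n) ℝ) (φ : ℝ → ℝ)
    (hX : HessianOrder.IsElliptical P X μx Sx φ)
    (hY : HessianOrder.IsElliptical Q Y μy Sy φ)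
    (hφ : ∃ u : ℝ, 0 ≤ u ∧ φ u ≠ 1)
    (hX2 : MemLp X 2 P) (hY2 : MemLp Y 2 Q) :
    (HessianOrder.CpLE P X Q Y ↔
      μx = μy ∧ Sy - Sx ∈ HessianOrder.copositiveCone n) ∧
    (HessianOrder.CopLE P X Q Y ↔
      μx = μy ∧ Sy - Sx ∈ HessianOrder.completelyPositiveCone n) := by
  have hSymm : (Sy - Sx)ᵀ = Sy - Sx := hY.posSemidef.1.sub hX.posSemidef.1
  have hX1 := hX2.integrable one_le_two
  have hY1 := hY2.integrable one_le_two
  refine ⟨⟨fun h => ?_, ?_⟩, ⟨fun h => ?_, ?_⟩⟩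
  · obtain rfl := h.location_eq hX hY hX1 hY1 HessianOrder.zero_mem_completelyPositiveCone
    refine ⟨rfl, fun x hx => ?_⟩
    rw [← HessianOrder.trace_mul_vecMulVec_self, Matrix.trace_mul_comm]
    exact h.trace_nonneg hX hY hφ hX2 hY2
      (HessianOrder.vecMulVec_self_mem_completelyPositiveCone hx) (Matrix.transpose_vecMulVec x x)
  · rintro ⟨rfl, hcop⟩
    refine HessianOrder.hessianLE_of_trace_nonneg hX hY fun M hM => ?_
    rw [Matrix.trace_mul_comm]
    exact HessianOrder.trace_mul_nonneg_of_copositive_of_completelyPositive hcop hM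
  · obtain rfl := h.location_eq hX hY hX1 hY1 HessianOrder.zero_mem_copositiveCone
    exact ⟨rfl, HessianOrder.mem_completelyPositiveCone_of_trace_mul_nonneg hSymm fun M hM hMt =>
      h.trace_nonneg hX hY hφ hX2 hY2 hM hMt⟩
  · rintro ⟨rfl, hcp⟩
    exact HessianOrder.hessianLE_of_trace_nonneg hX hY fun M hM =>
      HessianOrder.trace_mul_nonneg_of_copositive_of_completelyPositive hM hcp
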